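/- **Setting.** Let $(\Omega,\mathcal F,P)$ be a probability space and $\{\mathcal F_n\}_{n\ge0}$ a nondecreasing sequence of sub-$\sigma$-algebras of $\mathcal F$ with $\mathcal F=\sigma(\bigcup_n\mathcal F_n)$ and $\mathcal F_0=\{\emptyset,\Omega\}$. A set $B\in\mathcal F_n$ is an atom of $\mathcal F_n$ if every $A\subset B$ with $A\in\mathcal F_n$ satisfies $P(A)=P(B)$ or $P(A)=0$; $A(\mathcal F_n)$ denotes the set of atoms of $\mathcal F_n$ of positive probability. Assume that each $\mathcal F_n$ is generated by countably many atoms of $\mathcal F_n$. Write $E$ for the expectation and $E_n$ for the conditional expectation given $\mathcal F_n$. Assume that $\{\mathcal F_n\}$ is regular: there is $R\ge2$ such that $f_n\le Rf_{n-1}$ a.s. for all $n\ge1$ and every non-negative martingale $(f_n)_{n\ge0}$ relative to $\{\mathcal F_n\}$. Let $p\in[1,\infty)$ and let $\phi:(0,1]\to(0,\infty)$ satisfy the doubling condition: there is $C>0$ with $\frac1C\le\frac{\phi(r)}{\phi(s)}\le C$ whenever $r,s\in(0,1]$ and $\frac12\le\frac rs\le2$. Assume moreover that there is $C>0$ with $$\int_0^r\phi(t)^p\,dt\le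 C\,r\,\phi(r)^p\quad\text{for all } r\in(0,1].$$ For (real- or complex-valued) $f\in L_1$ put $$\|f\|_{\widetilde{\mathcal L}_{p,\phi}}=\sup_{n\ge0}\ \sup_{B\in A(\mathcal F_n)}\frac1{\phi(P(B))}\left(\frac1{P(B)}\int_B|f-E_nf|^p\,dP\right)^{1/p}+|Ef|,$$ and let $$\widetilde{\mathcal L}_{p,\phi}=\{f\in L_1:\|f\|_{\widetilde{\mathcal L}_{p,\phi}}<\infty\},\qquad \widetilde{\mathcal L}_{p,\phi}(\mathcal F_n)=\{f\in\widetilde{\mathcal L}_{p,\phi}: f\text{ is }\mathcal F_n\text{-measurable}\}.$$ As usual, functions that agree a.s. are identified. An $\mathcal F$-measurable function $g$ is a pointwise multiplier on $\widetilde{\mathcal L}_{p,\phi}$, written $g\in\mathrm{PWM}(\widetilde{\mathcal L}_{p,\phi})$, if $fg\in\widetilde{\mathcal L}_{p,\phi}$ for every $f\in\widetilde{\mathcal L}_{p,\phi}$. Likewise $\mathrm{PWM}(\widetilde{\mathcal L}_{p,\phi}(\mathcal F_n))$ is the set of $\mathcal F_n$-measurable $g$ with $fg\in\widetilde{\mathcal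 L}_{p,\phi}(\mathcal F_n)$ for every $f\in\widetilde{\mathcal L}_{p,\phi}(\mathcal F_n)$, and for such $g$ $$\|g\|_{Op}=\sup\left\{\frac{\|fg\|_{\widetilde{\mathcal L}_{p,\phi}}}{\|f\|_{\widetilde{\mathcal L}_{p,\phi}}}:\ f\in\widetilde{\mathcal L}_{p,\phi}(\mathcal F_n),\ f\not\equiv0\right\}.$$ **Theorem 1.4.** Let $g\in L_1$ and $g_n=E_ng$ for $n\ge0$. 1. If $g\in\mathrm{PWM}(\widetilde{\mathcal L}_{p,\phi})$, then $g_n\in\mathrm{PWM}(\widetilde{\mathcal L}_{p,\phi}(\mathcal F_n))$ for every $n\ge0$. 2. Conversely, if $g_n\in\mathrm{PWM}(\widetilde{\mathcal L}_{p,\phi}(\mathcal F_n))$ for every $n\ge0$ and $\sup_{n\ge0}\|g_n\|_{Op}<\infty$, then $g\in\mathrm{PWM}(\widetilde{\mathcal L}_{p,\phi})$. -/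

import Mathlib

open MeasureTheory
open scoped ENNReal

namespace MartingaleCampanato

variable {Ω : Type*}

/-- `B` is an `(m, P)`-atom: `B ∈ m`, and every `A ⊆ B` with `A ∈ m` satisfies
`P A = P B` or `P A = 0`. -/
def IsAtom (m : MeasurableSpace Ω) {mΩ : MeasurableSpace Ω} (P : Measure Ω) (B : Set Ω) : Prop :=
  MeasurableSet[m] B ∧ ∀ A : Set Ω, MeasurableSet[m] A → A ⊆ B → P A = P B ∨ P A = 0

/-- The σ-algebra `m` is generated by countably many `(m, P)`-atoms. -/
def GeneratedByCountableAtoms (m : MeasurableSpace Ω) {mΩ : MeasurableSpace Ω}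
    (P : Measure Ω) : Prop :=
  ∃ S : Set (Set Ω), S.Countable ∧ (∀ B ∈ S, IsAtom m P B) ∧ m = MeasurableSpace.generateFrom S

/-- The filtration is regular: there is `R ≥ 2` with `f_n ≤ R f_{n-1}` almost surely for every
non-negative martingale `f`. (For `n = 0` the convention `f_{-1} = f_0` makes this trivial.) -/
def IsRegular {mΩ : MeasurableSpace Ω} (ℱ : Filtration ℕ mΩ) (P : Measure Ω) : Prop :=
  ∃ R : ℝ, 2 ≤ R ∧ ∀ f : ℕ → Ω → ℝ, Martingale f ℱ P → (∀ n, 0 ≤ᵐ[P] f n) →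
    ∀ n, ∀ᵐ ω ∂P, f (n + 1) ω ≤ R * f n ω

/-- The doubling condition for a function on `(0, 1]`. -/
def Doubling (φ : ℝ → ℝ) : Prop :=
  ∃ C : ℝ, 0 < C ∧ ∀ r ∈ Set.Ioc (0 : ℝ) 1, ∀ s ∈ Set.Ioc (0 : ℝ) 1,
    1 / 2 ≤ r / s → r / s ≤ 2 → 1 / C ≤ φ r / φ s ∧ φ r / φ s ≤ C

/-- `∫_0^r φ(t)^p dt ≤ C r φ(r)^p` for all `r ∈ (0, 1]`; the integral is taken in `[0, ∞]`, so
that the inequality includes the convergence of the integral. -/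
def IntegralCondition (p : ℝ) (φ : ℝ → ℝ) : Prop :=
  ∃ C : ℝ, 0 < C ∧ ∀ r ∈ Set.Ioc (0 : ℝ) 1,
    ∫⁻ t in Set.Ioc 0 r, ENNReal.ofReal (φ t ^ p) ≤ ENNReal.ofReal (C * r * φ r ^ p)

variable {𝕜 : Type*} [RCLike 𝕜]

/-- The Campanato seminorm, with values in `[0, ∞]`: the supremum over `n ≥ 0` and over the atoms
`B` of `ℱ n` (of positive probability, so that `φ (P B)` makes sense) of
`φ(P B)⁻¹ (P(B)⁻¹ ∫_B |f - E_n f|^p dP)^{1/p}`. -/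
noncomputable def campanatoSeminorm {mΩ : MeasurableSpace Ω} (ℱ : Filtration ℕ mΩ)
    (P : Measure Ω) (p : ℝ) (φ : ℝ → ℝ) (f : Ω → 𝕜) : ℝ≥0∞ :=
  ⨆ (n : ℕ) (B : Set Ω) (_ : IsAtom (ℱ n) P B ∧ 0 < P B),
    ENNReal.ofReal (1 / φ (P.real B)) *
      ((P B)⁻¹ * ∫⁻ ω in B, ‖f ω - (P[f | ℱ n]) ω‖ₑ ^ p ∂P) ^ (1 / p)

/-- The Campanato norm: the Campanato seminorm plus `|E f|`. -/
noncomputable def campanatoNorm {mΩ : MeasurableSpace Ω} (ℱ : Filtration ℕ mΩ)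
    (P : Measure Ω) (p : ℝ) (φ : ℝ → ℝ) (f : Ω → 𝕜) : ℝ≥0∞ :=
  campanatoSeminorm ℱ P p φ f + ‖∫ ω, f ω ∂P‖ₑ

/-- The generalized Campanato space of `m`-measurable functions: the `f ∈ L_1` that are
`m`-measurable (up to almost sure equality, as usual) and have a finite Campanato norm.
For `m = mΩ` it is the whole Campanato space, for `m = ℱ n` it is the subspace of its
`ℱ n`-measurable members. -/
def campanatoSpace (𝕜 : Type*) [RCLike 𝕜] (m : MeasurableSpace Ω)
    {mΩ : MeasurableSpace Ω} (ℱ : Filtration ℕ mΩ) (P : Measure Ω) (p : ℝ) (φ : ℝ → ℝ) : Set (Ω → 𝕜) :=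
  {f | AEStronglyMeasurable[m] f P ∧ Integrable f P ∧ campanatoNorm ℱ P p φ f < ∞}

/-- The pointwise multipliers on the Campanato space of `m`-measurable functions: the `m`-measurable
`g` such that `f g` is in the space for every `f` in the space. -/
def pointwiseMultipliers (𝕜 : Type*) [RCLike 𝕜] (m : MeasurableSpace Ω)
    {mΩ : MeasurableSpace Ω} (ℱ : Filtration ℕ mΩ) (P : Measure Ω) (p : ℝ) (φ : ℝ → ℝ) : Set (Ω → 𝕜) :=
  {g | AEStronglyMeasurable[m] g P ∧
    ∀ f ∈ campanatoSpace 𝕜 m ℱ P p φ, (fun ω => f ω * g ω) ∈ campanatoSpace 𝕜 m ℱ P p φ}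

/-- The operator norm, with values in `[0, ∞]`, of the multiplication by `g` on the Campanato space
of `m`-measurable functions: the supremum of `‖f g‖ / ‖f‖` over the `f` in the space
that are not almost surely zero. -/
noncomputable def multiplierNorm (m : MeasurableSpace Ω) {mΩ : MeasurableSpace Ω}
    (ℱ : Filtration ℕ mΩ) (P : Measure Ω) (p : ℝ) (φ : ℝ → ℝ) (g : Ω → 𝕜) : ℝ≥0∞ :=
  ⨆ (f : Ω → 𝕜) (_ : f ∈ campanatoSpace 𝕜 m ℱ P p φ ∧ ¬ f =ᵐ[P] 0),
    campanatoNorm ℱ P p φ (fun ω => f ω * g ω) / campanatoNorm ℱ P p φ f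

end MartingaleCampanato

/-!
Conditional expectations are `L^p`-contractions on the sets of the conditioning σ-algebra, so
`f ↦ E_n f` does not increase the Campanato norm. For `ℱ n`-measurable `f` the pull-out property
`E_n (f g) = f E_n g` then turns a multiplier `g` into a multiplier `E_n g`.

Conversely, `f g` is the almost sure limit of the products `E_k f * E_k g`, whose Campanato norms
are bounded, and the Campanato space is closed under such limits `h k → h'`: on an atom of `ℱ n`
the function `E_n (h k)` is a constant `c k`, and by Fatou's lemma the `c k` cannot escape to
infinity, because the `h k - c k` are bounded in `L^p` while the `h k` converge. Along a
subsequence `c k → a`, so that `h' - a` obeys the same `L^p` bound, and `E_n h'` approximates `h'`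
as well as the constant `a` does, up to a factor `2`.
-/

open Filter Topology

namespace MartingaleCampanato

variable {Ω : Type*} {mΩ : MeasurableSpace Ω} {P : Measure Ω}

section ConditionalExpectation

variable {E : Type*} [NormedAddCommGroup E] [NormedSpace ℝ E] {m : MeasurableSpace Ω} {q : ℝ≥0∞}

theorem eLpNorm_condExp_restrict_le [CompleteSpace E] (hm : m ≤ mΩ) {f : Ω → E}
    (hf : Integrable f P) {B : Set Ω} (hB : MeasurableSet[m] B) (hq : 1 ≤ q) :
    eLpNorm (P[f | m]) q (P.restrict B) ≤ eLpNorm f q (P.restrict B) := by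
  rw [← eLpNorm_indicator_eq_eLpNorm_restrict (hm _ hB),
    ← eLpNorm_indicator_eq_eLpNorm_restrict (hm _ hB),
    ← eLpNorm_congr_ae (condExp_indicator hf hB)]
  exact eLpNorm_condExp_le_eLpNorm _ hq

theorem eLpNorm_sub_condExp_restrict_le [CompleteSpace E] (hm : m ≤ mΩ) [SigmaFinite (P.trim hm)]
    {f v : Ω → E} (hf : Integrable f P) (hv : AEStronglyMeasurable[m] v P) (hvi : Integrable v P)
    {B : Set Ω} (hB : MeasurableSet[m] B) (hq : 1 ≤ q) :
    eLpNorm (f - P[f | m]) q (P.restrict B) ≤ 2 * eLpNorm (f - v) q (P.restrict B) := by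
  have h : f - P[f | m] =ᵐ[P] (f - v) - P[f - v | m] := by
    filter_upwards [condExp_sub hf hvi m, condExp_of_aestronglyMeasurable' hm hv hvi] with ω h₁ h₂
    simp only [Pi.sub_apply, h₁, h₂, sub_sub_sub_cancel_right]
  calc eLpNorm (f - P[f | m]) q (P.restrict B)
      = eLpNorm ((f - v) - P[f - v | m]) q (P.restrict B) :=
        eLpNorm_congr_ae (ae_restrict_of_ae h)
    _ ≤ eLpNorm (f - v) q (P.restrict B) + eLpNorm (P[f - v | m]) q (P.restrict B) :=
        eLpNorm_sub_le (hf.sub hvi).aestronglyMeasurable.restrict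
          integrable_condExp.aestronglyMeasurable.restrict hq
    _ ≤ eLpNorm (f - v) q (P.restrict B) + eLpNorm (f - v) q (P.restrict B) := by
        gcongr
        exact eLpNorm_condExp_restrict_le hm (hf.sub hvi) hB hq
    _ = 2 * eLpNorm (f - v) q (P.restrict B) := (two_mul _).symm

theorem condExp_sub_condExp_condExp_ae_eq [CompleteSpace E] {m₁ m₂ : MeasurableSpace Ω}
    (hm₁₂ : m₁ ≤ m₂) (hm₂ : m₂ ≤ mΩ) [SigmaFinite (P.trim hm₂)] {f : Ω → E}
    (hf : Integrable f P) :
    P[f | m₂] - P[P[f | m₂] | m₁] =ᵐ[P] P[f - P[f | m₁] | m₂] := by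
  have hself : P[P[f | m₁] | m₂] = P[f | m₁] :=
    condExp_of_stronglyMeasurable hm₂ (stronglyMeasurable_condExp.mono hm₁₂) integrable_condExp
  filter_upwards [condExp_sub hf (integrable_condExp (f := f) (m := m₁)) m₂,
    condExp_condExp_of_le (f := f) (μ := P) hm₁₂ hm₂] with ω hsub htower
  rw [hsub, Pi.sub_apply, Pi.sub_apply, htower, hself]

theorem tendsto_ae_condExp_of_finiteDimensional [FiniteDimensional ℝ E] [IsFiniteMeasure P]
    (ℱ : Filtration ℕ mΩ) {f : Ω → E} (hf : Integrable f P) :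
    ∀ᵐ ω ∂P, Tendsto (fun n => (P[f | ℱ n]) ω) atTop (𝓝 ((P[f | ⨆ n, ℱ n]) ω)) := by
  have := FiniteDimensional.complete ℝ E
  let e := (Module.finBasis ℝ E).equivFunL
  let coord i : E →L[ℝ] ℝ := (ContinuousLinearMap.proj i).comp e.toContinuousLinearMap
  have hcoord : ∀ᵐ ω ∂P, ∀ i, Tendsto (fun n => coord i ((P[f | ℱ n]) ω)) atTop
      (𝓝 (coord i ((P[f | ⨆ n, ℱ n]) ω))) := by
    refine ae_all_iff.2 fun i => ?_
    filter_upwards [tendsto_ae_condExp (ℱ := ℱ) (μ := P) (coord i ∘ f),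
      ae_all_iff.2 fun n => (coord i).comp_condExp_comm (m := ℱ n) hf,
      (coord i).comp_condExp_comm (m := ⨆ n, ℱ n) hf] with ω hlim hn htop
    rw [← htop] at hlim
    exact hlim.congr fun n => (hn n).symm
  filter_upwards [hcoord] with ω hω
  have he : Tendsto (fun n => e ((P[f | ℱ n]) ω)) atTop (𝓝 (e ((P[f | ⨆ n, ℱ n]) ω))) :=
    tendsto_pi_nhds.2 hω
  simpa only [Function.comp_def, e.symm_apply_apply] using
    (e.symm.continuous.tendsto _).comp he

end ConditionalExpectation

section Limits

variable {E : Type*} [NormedAddCommGroup E] {q T : ℝ≥0∞}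

theorem ae_liminf_enorm_lt_top_of_eLpNorm_le (hq : q ≠ 0) {f : ℕ → Ω → E}
    (hf : ∀ k, AEStronglyMeasurable (f k) P) (hT : T ≠ ∞) (hbdd : ∀ k, eLpNorm (f k) q P ≤ T) :
    ∀ᵐ ω ∂P, liminf (fun k => ‖f k ω‖ₑ) atTop < ∞ := by
  borelize E
  lift T to NNReal using hT
  have hmk := ae_bdd_liminf_atTop_of_eLpNorm_bdd hq
    (fun k => (hf k).stronglyMeasurable_mk.measurable)
    fun k => (eLpNorm_congr_ae (hf k).ae_eq_mk.symm).trans_le (hbdd k)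
  filter_upwards [hmk, ae_all_iff.2 fun k => (hf k).ae_eq_mk] with ω hω heq
  simpa only [heq] using hω

theorem exists_eLpNorm_sub_const_le_of_tendsto [ProperSpace E] (hq : q ≠ 0) {h : ℕ → Ω → E}
    {h' : Ω → E} {c : ℕ → E} (hmeas : ∀ k, AEStronglyMeasurable (h k) P)
    (hlim : ∀ᵐ ω ∂P, Tendsto (fun k => h k ω) atTop (𝓝 (h' ω)))
    (hT : T ≠ ∞) (hbdd : ∀ k, eLpNorm (h k - fun _ => c k) q P ≤ T) :
    ∃ a : E, eLpNorm (h' - fun _ => a) q P ≤ T := by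
  obtain rfl | hP := eq_or_ne P 0
  · exact ⟨0, by simp only [eLpNorm_measure_zero, zero_le]⟩
  have : NeZero P := ⟨hP⟩
  have hmeas_sub k : AEStronglyMeasurable (h k - fun _ => c k) P :=
    (hmeas k).sub aestronglyMeasurable_const
  obtain ⟨ω, hω, hliminf⟩ :=
    (hlim.and (ae_liminf_enorm_lt_top_of_eLpNorm_le hq hmeas_sub hT hbdd)).exists
  obtain ⟨L, hL, -⟩ := ENNReal.lt_iff_exists_nnreal_btwn.1 hliminf
  have hfreq : ∃ᶠ k in atTop, c k ∈ Metric.ball (h' ω) (L + 1) := by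
    refine ((frequently_lt_of_liminf_lt (h := hL)).and_eventually
      (hω.eventually (Metric.ball_mem_nhds _ one_pos))).mono fun k ⟨hck, hk⟩ => ?_
    have hck' : dist (c k) (h k ω) < L := by
      rwa [dist_comm, dist_eq_norm, ← coe_nnnorm, NNReal.coe_lt_coe, ← ENNReal.coe_lt_coe]
    exact (dist_triangle _ _ _).trans_lt (add_lt_add hck' hk)
  obtain ⟨a, -, s, hs, ha⟩ := tendsto_subseq_of_frequently_bounded Metric.isBounded_ball hfreq
  refine ⟨a, Lp.eLpNorm_le_of_ae_tendsto (u := atTop) (.of_forall fun k => hbdd (s k))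
    (fun k => hmeas_sub (s k)) ?_⟩
  filter_upwards [hlim] with ω hω
  exact (hω.comp hs.tendsto_atTop).sub ha

end Limits

section Atoms

theorem isAtom_bot_univ : IsAtom ⊥ P Set.univ := by
  refine ⟨MeasurableSet.univ, fun A hA _ => ?_⟩
  obtain rfl | rfl := MeasurableSpace.measurableSet_bot_iff.1 hA
  · exact .inr measure_empty
  · exact .inl rfl

theorem IsAtom.exists_ae_eq_const [IsFiniteMeasure P] {β : Type*} [Nonempty β] [MeasurableSpace β]
    [MeasurableSpace.CountablySeparated β] {m : MeasurableSpace Ω} (hm : m ≤ mΩ) {B : Set Ω}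
    (hB : IsAtom m P B) {u : Ω → β} (hu : Measurable[m] u) :
    ∃ c : β, u =ᵐ[P.restrict B] fun _ => c := by
  refine exists_eventuallyEq_const_of_forall_separating MeasurableSet fun U hU => ?_
  have hBU : MeasurableSet[m] (B ∩ u ⁻¹' U) := hB.1.inter (hu hU)
  rw [ae_restrict_iff' (hm _ hB.1), ae_restrict_iff' (hm _ hB.1)]
  rcases hB.2 _ hBU Set.inter_subset_left with hfull | hnull
  · left
    have hae : (B ∩ u ⁻¹' U : Set Ω) =ᵐ[P] B := ae_eq_of_subset_of_measure_ge
      Set.inter_subset_left hfull.ge (hm _ hBU).nullMeasurableSet (measure_ne_top P B)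
    filter_upwards [hae.mem_iff] with ω hω hωB using (hω.2 hωB).2
  · right
    filter_upwards [measure_eq_zero_iff_ae_notMem.1 hnull] with ω hω hωB hωU using hω ⟨hωB, hωU⟩

end Atoms

section Campanato

variable {𝕜 : Type*} [RCLike 𝕜] {ℱ : Filtration ℕ mΩ} {p : ℝ} {φ : ℝ → ℝ}

/-- The factor `φ(P B)⁻¹ P(B)^{-1/p}` by which the Campanato seminorm multiplies the
`L^p`-oscillation of a function on the atom `B`. -/
noncomputable def atomWeight (P : Measure Ω) (p : ℝ) (φ : ℝ → ℝ) (B : Set Ω) : ℝ≥0∞ :=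
  ENNReal.ofReal (1 / φ (P.real B)) * (P B)⁻¹ ^ (1 / p)

theorem atomWeight_ne_zero [IsFiniteMeasure P] (hp : 0 ≤ p) {B : Set Ω}
    (hφ : 0 < φ (P.real B)) : atomWeight P p φ B ≠ 0 :=
  mul_ne_zero (ENNReal.ofReal_pos.2 (one_div_pos.2 hφ)).ne'
    (ENNReal.rpow_pos_of_nonneg (ENNReal.inv_pos.2 (measure_ne_top P B))
      (one_div_nonneg.2 hp)).ne'

theorem atomWeight_mul_eLpNorm (hp : 0 < p) (φ : ℝ → ℝ) (B : Set Ω) (u : Ω → 𝕜) :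
    atomWeight P p φ B * eLpNorm u (ENNReal.ofReal p) (P.restrict B) =
      ENNReal.ofReal (1 / φ (P.real B)) *
        ((P B)⁻¹ * ∫⁻ ω in B, ‖u ω‖ₑ ^ p ∂P) ^ (1 / p) := by
  rw [eLpNorm_eq_lintegral_rpow_enorm_toReal (ENNReal.ofReal_pos.2 hp).ne' ENNReal.ofReal_ne_top,
    ENNReal.toReal_ofReal hp.le, ENNReal.mul_rpow_of_nonneg _ _ (one_div_nonneg.2 hp.le),
    atomWeight, mul_assoc]

theorem campanatoSeminorm_eq_iSup_eLpNorm (hp : 0 < p) (f : Ω → 𝕜) :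
    campanatoSeminorm ℱ P p φ f =
      ⨆ (n : ℕ) (B : Set Ω) (_ : IsAtom (ℱ n) P B ∧ 0 < P B),
        atomWeight P p φ B * eLpNorm (f - P[f | ℱ n]) (ENNReal.ofReal p) (P.restrict B) := by
  simp only [campanatoSeminorm, atomWeight_mul_eLpNorm hp, Pi.sub_apply]

theorem campanatoSeminorm_le_iff (hp : 0 < p) {f : Ω → 𝕜} {N : ℝ≥0∞} :
    campanatoSeminorm ℱ P p φ f ≤ N ↔ ∀ (n : ℕ) (B : Set Ω), IsAtom (ℱ n) P B → 0 < P B →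
      atomWeight P p φ B * eLpNorm (f - P[f | ℱ n]) (ENNReal.ofReal p) (P.restrict B) ≤ N := by
  simp only [campanatoSeminorm_eq_iSup_eLpNorm hp, iSup_le_iff, and_imp]

theorem campanatoSeminorm_congr_ae (hp : 0 < p) {f g : Ω → 𝕜} (h : f =ᵐ[P] g) :
    campanatoSeminorm ℱ P p φ f = campanatoSeminorm ℱ P p φ g := by
  have hosc (n : ℕ) (B : Set Ω) :
      eLpNorm (f - P[f | ℱ n]) (ENNReal.ofReal p) (P.restrict B) =
        eLpNorm (g - P[g | ℱ n]) (ENNReal.ofReal p) (P.restrict B) :=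
    eLpNorm_congr_ae (ae_restrict_of_ae (h.sub (condExp_congr_ae h)))
  simp only [campanatoSeminorm_eq_iSup_eLpNorm hp, hosc]

theorem campanatoNorm_congr_ae (hp : 0 < p) {f g : Ω → 𝕜} (h : f =ᵐ[P] g) :
    campanatoNorm ℱ P p φ f = campanatoNorm ℱ P p φ g := by
  rw [campanatoNorm, campanatoNorm, campanatoSeminorm_congr_ae hp h, integral_congr_ae h]

theorem campanatoNorm_zero (hp : 0 < p) : campanatoNorm ℱ P p φ (0 : Ω → 𝕜) = 0 := by
  simp [campanatoNorm, campanatoSeminorm_eq_iSup_eLpNorm hp]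

theorem campanatoSpace_mono {m m' : MeasurableSpace Ω} (h : m ≤ m') :
    campanatoSpace 𝕜 m ℱ P p φ ⊆ campanatoSpace 𝕜 m' ℱ P p φ :=
  fun _ hf => ⟨hf.1.mono h, hf.2⟩

theorem mem_campanatoSpace_congr_ae (hp : 0 < p) {m : MeasurableSpace Ω} {f g : Ω → 𝕜}
    (h : f =ᵐ[P] g) (hf : f ∈ campanatoSpace 𝕜 m ℱ P p φ) : g ∈ campanatoSpace 𝕜 m ℱ P p φ :=
  ⟨hf.1.congr h, hf.2.1.congr h, campanatoNorm_congr_ae hp h ▸ hf.2.2⟩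

section Contraction

variable [IsFiniteMeasure P]

theorem campanatoSeminorm_condExp_le (hp : 1 ≤ p) {f : Ω → 𝕜} (hf : Integrable f P) (k : ℕ) :
    campanatoSeminorm ℱ P p φ (P[f | ℱ k]) ≤ campanatoSeminorm ℱ P p φ f := by
  have hp₀ : 0 < p := one_pos.trans_le hp
  refine (campanatoSeminorm_le_iff hp₀).2 fun n B hB hPB => ?_
  rcases le_total n k with hnk | hkn
  · refine le_trans ?_ ((campanatoSeminorm_le_iff hp₀).1 le_rfl n B hB hPB)
    gcongr
    rw [eLpNorm_congr_ae
      (ae_restrict_of_ae (condExp_sub_condExp_condExp_ae_eq (ℱ.mono hnk) (ℱ.le k) hf))]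
    exact eLpNorm_condExp_restrict_le (ℱ.le k) (hf.sub integrable_condExp)
      (ℱ.mono hnk _ hB.1) (ENNReal.one_le_ofReal.2 hp)
  · rw [condExp_of_stronglyMeasurable (ℱ.le n) (stronglyMeasurable_condExp.mono (ℱ.mono hkn))
      integrable_condExp, sub_self, eLpNorm_zero, mul_zero]
    exact zero_le

theorem campanatoNorm_condExp_le (hp : 1 ≤ p) {f : Ω → 𝕜} (hf : Integrable f P) (k : ℕ) :
    campanatoNorm ℱ P p φ (P[f | ℱ k]) ≤ campanatoNorm ℱ P p φ f := by
  rw [campanatoNorm, campanatoNorm, integral_condExp (ℱ.le k)]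
  gcongr
  exact campanatoSeminorm_condExp_le hp hf k

theorem condExp_mem_campanatoSpace (hp : 1 ≤ p) {f : Ω → 𝕜}
    (hf : f ∈ campanatoSpace 𝕜 mΩ ℱ P p φ) (k : ℕ) :
    P[f | ℱ k] ∈ campanatoSpace 𝕜 (ℱ k) ℱ P p φ :=
  ⟨stronglyMeasurable_condExp.aestronglyMeasurable, integrable_condExp,
    (campanatoNorm_condExp_le hp hf.2.1 k).trans_lt hf.2.2⟩

end Contraction

section Closure

variable [IsProbabilityMeasure P] {h : ℕ → Ω → 𝕜} {h' : Ω → 𝕜} {N : ℝ≥0∞}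

theorem IsAtom.exists_eLpNorm_sub_const_le_div_atomWeight (hp : 1 ≤ p)
    (hφ : ∀ r ∈ Set.Ioc (0 : ℝ) 1, 0 < φ r) {n : ℕ} {B : Set Ω} (hB : IsAtom (ℱ n) P B)
    (hPB : 0 < P B) (hmeas : ∀ k, AEStronglyMeasurable (h k) P)
    (hlim : ∀ᵐ ω ∂P, Tendsto (fun k => h k ω) atTop (𝓝 (h' ω))) (hN : N ≠ ∞)
    (hbdd : ∀ k, campanatoSeminorm ℱ P p φ (h k) ≤ N) :
    ∃ a : 𝕜, eLpNorm (h' - fun _ => a) (ENNReal.ofReal p) (P.restrict B) ≤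
      N / atomWeight P p φ B := by
  have hp₀ : 0 < p := one_pos.trans_le hp
  have hw : atomWeight P p φ B ≠ 0 := atomWeight_ne_zero hp₀.le
    (hφ _ ⟨ENNReal.toReal_pos hPB.ne' (measure_ne_top P B), measureReal_le_one⟩)
  choose c hc using fun k => hB.exists_ae_eq_const (ℱ.le n)
    (stronglyMeasurable_condExp (f := h k) (m := ℱ n) (μ := P)).measurable
  refine exists_eLpNorm_sub_const_le_of_tendsto (c := c)
    (ENNReal.ofReal_pos.2 hp₀).ne' (fun k => (hmeas k).restrict) (ae_restrict_of_ae hlim)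
    (ENNReal.div_ne_top hN hw) fun k => ?_
  rw [← eLpNorm_congr_ae (EventuallyEq.rfl.sub (hc k)),
    ENNReal.le_div_iff_mul_le (.inl hw) (.inr hN), mul_comm]
  exact (campanatoSeminorm_le_iff hp₀).1 (hbdd k) n B hB hPB

theorem integrable_of_tendsto_of_campanatoSeminorm_le (hΩ : IsAtom (ℱ 0) P Set.univ) (hp : 1 ≤ p)
    (hφ : ∀ r ∈ Set.Ioc (0 : ℝ) 1, 0 < φ r) (hmeas : ∀ k, AEStronglyMeasurable (h k) P)
    (hlim : ∀ᵐ ω ∂P, Tendsto (fun k => h k ω) atTop (𝓝 (h' ω))) (hN : N ≠ ∞)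
    (hbdd : ∀ k, campanatoSeminorm ℱ P p φ (h k) ≤ N) :
    Integrable h' P := by
  obtain ⟨a, ha⟩ := hΩ.exists_eLpNorm_sub_const_le_div_atomWeight hp hφ (by simp) hmeas hlim hN hbdd
  have hw : atomWeight P p φ Set.univ ≠ 0 :=
    atomWeight_ne_zero (zero_le_one.trans hp) (hφ _ (by simp))
  have hsub : MemLp (h' - fun _ => a) (ENNReal.ofReal p) P := by
    refine ⟨(aestronglyMeasurable_of_tendsto_ae atTop hmeas hlim).sub
      aestronglyMeasurable_const, ?_⟩
    rw [← Measure.restrict_univ (μ := P)]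
    exact ha.trans_lt (ENNReal.div_lt_top hN hw)
  simpa only [sub_add_cancel] using
    (hsub.integrable (ENNReal.one_le_ofReal.2 hp)).add (integrable_const a)

theorem campanatoSeminorm_le_of_tendsto (hp : 1 ≤ p) (hφ : ∀ r ∈ Set.Ioc (0 : ℝ) 1, 0 < φ r)
    (hmeas : ∀ k, AEStronglyMeasurable (h k) P) (hint : Integrable h' P)
    (hlim : ∀ᵐ ω ∂P, Tendsto (fun k => h k ω) atTop (𝓝 (h' ω))) (hN : N ≠ ∞)
    (hbdd : ∀ k, campanatoSeminorm ℱ P p φ (h k) ≤ N) :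
    campanatoSeminorm ℱ P p φ h' ≤ 2 * N := by
  refine (campanatoSeminorm_le_iff (one_pos.trans_le hp)).2 fun n B hB hPB => ?_
  obtain ⟨a, ha⟩ := hB.exists_eLpNorm_sub_const_le_div_atomWeight hp hφ hPB hmeas hlim hN hbdd
  calc atomWeight P p φ B * eLpNorm (h' - P[h' | ℱ n]) (ENNReal.ofReal p) (P.restrict B)
      ≤ atomWeight P p φ B *
          (2 * eLpNorm (h' - fun _ => a) (ENNReal.ofReal p) (P.restrict B)) := by
        gcongr
        exact eLpNorm_sub_condExp_restrict_le (ℱ.le n) hint aestronglyMeasurable_const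
          (integrable_const a) hB.1 (ENNReal.one_le_ofReal.2 hp)
    _ ≤ atomWeight P p φ B * (2 * (N / atomWeight P p φ B)) := by gcongr
    _ = 2 * (atomWeight P p φ B * (N / atomWeight P p φ B)) := mul_left_comm _ _ _
    _ ≤ 2 * N := by
        gcongr
        exact ENNReal.mul_div_le

theorem mem_campanatoSpace_of_tendsto (hΩ : IsAtom (ℱ 0) P Set.univ) (hp : 1 ≤ p)
    (hφ : ∀ r ∈ Set.Ioc (0 : ℝ) 1, 0 < φ r) (hmeas : ∀ k, AEStronglyMeasurable (h k) P)
    (hlim : ∀ᵐ ω ∂P, Tendsto (fun k => h k ω) atTop (𝓝 (h' ω))) (hN : N ≠ ∞)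
    (hbdd : ∀ k, campanatoSeminorm ℱ P p φ (h k) ≤ N) :
    h' ∈ campanatoSpace 𝕜 mΩ ℱ P p φ := by
  have hint := integrable_of_tendsto_of_campanatoSeminorm_le hΩ hp hφ hmeas hlim hN hbdd
  have hosc := campanatoSeminorm_le_of_tendsto hp hφ hmeas hint hlim hN hbdd
  exact ⟨hint.aestronglyMeasurable, hint, ENNReal.add_lt_top.2
    ⟨hosc.trans_lt (ENNReal.mul_lt_top ENNReal.ofNat_lt_top hN.lt_top), enorm_lt_top⟩⟩

end Closure

section Multipliers

variable {f g : Ω → 𝕜}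

theorem campanatoNorm_mul_le_multiplierNorm_mul {m : MeasurableSpace Ω} (hp : 0 < p)
    (hf : f ∈ campanatoSpace 𝕜 m ℱ P p φ) (hg : multiplierNorm m ℱ P p φ g ≠ ∞) :
    campanatoNorm ℱ P p φ (fun ω => f ω * g ω) ≤
      multiplierNorm m ℱ P p φ g * campanatoNorm ℱ P p φ f := by
  by_cases hf₀ : f =ᵐ[P] 0
  · have hfg : (fun ω => f ω * g ω) =ᵐ[P] 0 := by
      filter_upwards [hf₀] with ω hω
      simp only [hω, Pi.zero_apply, zero_mul]
    rw [campanatoNorm_congr_ae hp hfg, campanatoNorm_zero hp]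
    exact zero_le
  · rw [← ENNReal.div_le_iff_le_mul (.inr hg) (.inl hf.2.2.ne)]
    exact le_iSup₂_of_le f ⟨hf, hf₀⟩ le_rfl

theorem condExp_mem_pointwiseMultipliers [IsFiniteMeasure P] (hp : 1 ≤ p) (hg : Integrable g P)
    (hgm : g ∈ pointwiseMultipliers 𝕜 mΩ ℱ P p φ) (n : ℕ) :
    P[g | ℱ n] ∈ pointwiseMultipliers 𝕜 (ℱ n) ℱ P p φ := by
  refine ⟨stronglyMeasurable_condExp.aestronglyMeasurable, fun f hf => ?_⟩
  have hfg := hgm.2 f (campanatoSpace_mono (ℱ.le n) hf)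
  have hpull : P[fun ω => f ω * g ω | ℱ n] =ᵐ[P] fun ω => f ω * (P[g | ℱ n]) ω :=
    condExp_bilin_of_aestronglyMeasurable_left (.mul ℝ 𝕜) hf.1 hfg.2.1 hg
  exact mem_campanatoSpace_congr_ae (one_pos.trans_le hp) hpull
    (condExp_mem_campanatoSpace hp hfg n)

theorem mem_pointwiseMultipliers_of_condExp [IsProbabilityMeasure P] (hgen : ⨆ n, ℱ n = mΩ)
    (hΩ : IsAtom (ℱ 0) P Set.univ) (hp : 1 ≤ p) (hφ : ∀ r ∈ Set.Ioc (0 : ℝ) 1, 0 < φ r)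
    (hg : Integrable g P) (hgn : ∀ n, P[g | ℱ n] ∈ pointwiseMultipliers 𝕜 (ℱ n) ℱ P p φ)
    (hM : ⨆ n, multiplierNorm (ℱ n) ℱ P p φ (P[g | ℱ n]) < ∞) :
    g ∈ pointwiseMultipliers 𝕜 mΩ ℱ P p φ := by
  refine ⟨hg.aestronglyMeasurable, fun f hf => ?_⟩
  have hlevy {u : Ω → 𝕜} (hu : Integrable u P) :
      ∀ᵐ ω ∂P, Tendsto (fun n => (P[u | ℱ n]) ω) atTop (𝓝 (u ω)) := by
    have hself : P[u | ⨆ n, ℱ n] =ᵐ[P] u := by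
      rw [hgen]
      exact condExp_of_aestronglyMeasurable' le_rfl hu.aestronglyMeasurable hu
    filter_upwards [tendsto_ae_condExp_of_finiteDimensional ℱ hu, hself] with ω hlim hω
    rwa [hω] at hlim
  have hlim : ∀ᵐ ω ∂P, Tendsto (fun n => (P[f | ℱ n]) ω * (P[g | ℱ n]) ω) atTop
      (𝓝 (f ω * g ω)) := by
    filter_upwards [hlevy hf.2.1, hlevy hg] with ω hfω hgω using hfω.mul hgω
  have hfn := condExp_mem_campanatoSpace hp hf
  have hle := le_iSup fun n => multiplierNorm (ℱ n) ℱ P p φ (P[g | ℱ n])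
  have hbdd (n : ℕ) : campanatoNorm ℱ P p φ (fun ω => (P[f | ℱ n]) ω * (P[g | ℱ n]) ω) ≤
      (⨆ n, multiplierNorm (ℱ n) ℱ P p φ (P[g | ℱ n])) * campanatoNorm ℱ P p φ f :=
    (campanatoNorm_mul_le_multiplierNorm_mul (one_pos.trans_le hp) (hfn n)
      ((hle n).trans_lt hM).ne).trans (mul_le_mul' (hle n) (campanatoNorm_condExp_le hp hf.2.1 n))
  exact mem_campanatoSpace_of_tendsto hΩ hp hφ
    (fun n => ((hgn n).2 _ (hfn n)).2.1.aestronglyMeasurable) hlim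
    (ENNReal.mul_ne_top hM.ne hf.2.2.ne) fun n => le_self_add.trans (hbdd n)

end Multipliers

end Campanato

end MartingaleCampanato

theorem theorem1p4_general {𝕜 : Type*} [RCLike 𝕜] {Ω : Type*} {mΩ : MeasurableSpace Ω}
    (P : Measure Ω) [IsProbabilityMeasure P] (ℱ : Filtration ℕ mΩ)
    (hgen : ⨆ n, ℱ n = mΩ)
    (hΩ : MartingaleCampanato.IsAtom (ℱ 0) P Set.univ)
    (p : ℝ) (hp : 1 ≤ p)
    (φ : ℝ → ℝ) (hφ : ∀ r ∈ Set.Ioc (0 : ℝ) 1, 0 < φ r)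
    (g : Ω → 𝕜) (hg : Integrable g P) :
    (g ∈ MartingaleCampanato.pointwiseMultipliers 𝕜 mΩ ℱ P p φ →
      ∀ n, P[g | ℱ n] ∈ MartingaleCampanato.pointwiseMultipliers 𝕜 (ℱ n) ℱ P p φ) ∧
    ((∀ n, P[g | ℱ n] ∈ MartingaleCampanato.pointwiseMultipliers 𝕜 (ℱ n) ℱ P p φ) →
      ⨆ n, MartingaleCampanato.multiplierNorm (ℱ n) ℱ P p φ (P[g | ℱ n]) < ∞ →
      g ∈ MartingaleCampanato.pointwiseMultipliers 𝕜 mΩ ℱ P p φ) :=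
  ⟨MartingaleCampanato.condExp_mem_pointwiseMultipliers hp hg,
    MartingaleCampanato.mem_pointwiseMultipliers_of_condExp hgen hΩ hp hφ hg⟩

theorem theorem1p4 {𝕜 : Type*} [RCLike 𝕜] {Ω : Type*} {mΩ : MeasurableSpace Ω}
    (P : Measure Ω) [IsProbabilityMeasure P] (ℱ : Filtration ℕ mΩ)
    (hgen : ⨆ n, ℱ n = mΩ)
    (hzero : ℱ 0 = ⊥)
    (hatoms : ∀ n, MartingaleCampanato.GeneratedByCountableAtoms (ℱ n) P)
    (hreg : MartingaleCampanato.IsRegular ℱ P)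
    (p : ℝ) (hp : 1 ≤ p)
    (φ : ℝ → ℝ) (hφ : ∀ r ∈ Set.Ioc (0 : ℝ) 1, 0 < φ r)
    (hdoubling : MartingaleCampanato.Doubling φ)
    (hint : MartingaleCampanato.IntegralCondition p φ)
    (g : Ω → 𝕜) (hg : Integrable g P) :
    (g ∈ MartingaleCampanato.pointwiseMultipliers 𝕜 mΩ ℱ P p φ →
      ∀ n, P[g | ℱ n] ∈ MartingaleCampanato.pointwiseMultipliers 𝕜 (ℱ n) ℱ P p φ) ∧
    ((∀ n, P[g | ℱ n] ∈ MartingaleCampanato.pointwiseMultipliers 𝕜 (ℱ n) ℱ P p φ) →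
      ⨆ n, MartingaleCampanato.multiplierNorm (ℱ n) ℱ P p φ (P[g | ℱ n]) < ∞ →
      g ∈ MartingaleCampanato.pointwiseMultipliers 𝕜 mΩ ℱ P p φ) :=
  theorem1p4_general P ℱ hgen (hzero ▸ MartingaleCampanato.isAtom_bot_univ) p hp φ hφ g hg
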